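/- Let $(\mathcal X,\mathcal B)$ be a measurable space, $P$ a probability measure on it, and $\varphi:\mathbb R\to[0,+\infty]$ a closed (i.e. lower semicontinuous) convex function with $\varphi(1)=0$ whose domain $\{x:\varphi(x)<\infty\}$ is an interval with endpoints $a_\varphi<1<b_\varphi$, where $-\infty\le a_\varphi$ and $b_\varphi\le+\infty$. Let $\varphi^*(t):=\sup_{x\in\mathbb R}\{tx-\varphi(x)\}$. For a finite signed measure $Q$ put $\phi(Q,P):=\int_{\mathcal X}\varphi\left(\frac{dQ}{dP}\right)dP$ if $Q\ll P$, and $\phi(Q,P):=+\infty$ otherwise; for a set $\Omega$ of finite signed measures put $\phi(\Omega,P):=\inf_{Q\in\Omega}\phi(Q,P)$. If $\phi(\Omega,P)<\infty$, a $\phi$-projection of $P$ on $\Omega$ is a $Q^*\in\Omega$ with $\phi(Q^*,P)\le\phi(Q,P)$ for all $Q\in\Omega$. Let $g_1,\dots,g_l:\mathcal X\to\mathbb R$ be measurable and let $M_g$ be the set of all finite signed measures $Q\ll P$ with $Q(\mathcal X)=1$, $\int|g_i|\,d|Q|<\infty$ and $\int g_i\,dQ=0$ for $i=1,\dots,l$.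 Consider the conditions - (A) $\phi(M_g,P)<\infty$; - (B) $\lim_{|x|\to\infty}\varphi(x)/|x|=+\infty$; - (C) $\int\varphi^*(\alpha|g_i|)\,dP<\infty$ for every $\alpha>0$ and all $i=1,\dots,l$; - (D) there are numbers $1<r,k<\infty$ with $r^{-1}+k^{-1}=1$, $\liminf_{|x|\to\infty}\varphi(x)/|x|^r>0$ and $\int |g_i|^k\,dP<\infty$ for all $i=1,\dots,l$; - (E) $g_1,\dots,g_l\in L_\infty(\mathcal X,P)$; - (F) $\varphi(0)=+\infty$; - (G) $\varphi$ is differentiable on $(a_\varphi,b_\varphi)$, $a_\varphi=0$, and $\varphi'(0):=\lim_{x\downarrow0}\varphi'(x)=-\infty$; and there is some $Q_0\in M_g$ with $\phi(Q_0,P)<\infty$ and $\frac{dQ_0}{dP}>0$ $P$-a.e. Then there exists at least one $\phi$-projection $Q^*$ of $P$ on $M_g$ with the same support as $P$, that is, with $\frac{dQ^*}{dP}>0$ $P$-a.e., in each of the following cases: 1. (A), (B), (C) and (F) hold; 2. (A), (D) and (F) hold; 3. (A) and (B) hold, and either (E) and (F), or (C) and (G), or (E) and (G) hold; 4. (A),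 (D) and (G) hold. -/

import Mathlib

open MeasureTheory Filter Topology Set
open scoped ENNReal NNReal

namespace PhiDivergence

noncomputable section

/-- The effective domain `{x ∈ ℝ | φ x < ∞}`. -/
def effDomain (φ : ℝ → ℝ≥0∞) : Set ℝ := {x | φ x < ⊤}

/-- The left endpoint `a_φ ∈ [-∞, ∞]` of the effective domain. -/
def leftEnd (φ : ℝ → ℝ≥0∞) : EReal := sInf ((fun x : ℝ => (x : EReal)) '' effDomain φ)

/-- The right endpoint `b_φ ∈ [-∞, ∞]` of the effective domain. -/
def rightEnd (φ : ℝ → ℝ≥0∞) : EReal := sSup ((fun x : ℝ => (x : EReal)) '' effDomain φ)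

/-- A closed convex function `φ : ℝ → [0, ∞]` with `φ 1 = 0` whose domain (an interval, by
convexity) has endpoints `a_φ < 1 < b_φ`.  For such functions closedness is lower
semicontinuity. -/
structure IsDivergenceFunction (φ : ℝ → ℝ≥0∞) : Prop where
  convex : ConvexOn ℝ≥0 univ φ
  closed : LowerSemicontinuous φ
  map_one : φ 1 = 0
  left_lt : leftEnd φ < 1
  lt_right : 1 < rightEnd φ

/-- The Fenchel–Legendre conjugate `φ^*(t) = sup_{x ∈ ℝ} (t x - φ x)`. -/
def conjugate (φ : ℝ → ℝ≥0∞) (t : ℝ) : EReal :=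
  ⨆ x : ℝ, (((t * x : ℝ) : EReal) - (φ x : EReal))

/-- `φ` is differentiable on the interior `(a_φ, b_φ)` of its domain. -/
def DifferentiableOnDomain (φ : ℝ → ℝ≥0∞) : Prop :=
  ∀ x : ℝ, leftEnd φ < x → (x : EReal) < rightEnd φ →
    DifferentiableAt ℝ (fun y => (φ y).toReal) x

variable {𝓧 : Type*} [MeasurableSpace 𝓧]

open Classical in
/-- The divergence `φ(Q, P) = ∫ φ(dQ/dP) dP` if `Q ≪ P`, and `∞` otherwise. -/
def divergence (φ : ℝ → ℝ≥0∞) (Q : SignedMeasure 𝓧) (P : Measure 𝓧) : ℝ≥0∞ :=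
  if Q ≪ᵥ P.toENNRealVectorMeasure then ∫⁻ x, φ (Q.rnDeriv P x) ∂P else ⊤

/-- `φ(Ω, P) = inf_{Q ∈ Ω} φ(Q, P)`. -/
def divergenceSet (φ : ℝ → ℝ≥0∞) (Ω : Set (SignedMeasure 𝓧)) (P : Measure 𝓧) : ℝ≥0∞ :=
  ⨅ Q ∈ Ω, divergence φ Q P

/-- `Qs` is a `φ`-projection of `P` on `Ω` (where `φ(Ω, P)` is finite). -/
structure IsProjection (φ : ℝ → ℝ≥0∞) (Ω : Set (SignedMeasure 𝓧)) (P : Measure 𝓧)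
    (Qs : SignedMeasure 𝓧) : Prop where
  finite : divergenceSet φ Ω P < ⊤
  mem : Qs ∈ Ω
  le : ∀ Q ∈ Ω, divergence φ Qs P ≤ divergence φ Q P

/-- The set `M_g` of finite signed measures `Q ≪ P` of total mass one that integrate
`g_1, …, g_l` (with respect to the total variation of `Q`) and satisfy `∫ g_i dQ = 0`. -/
def constraintSet {l : ℕ} (g : Fin l → 𝓧 → ℝ) (P : Measure 𝓧) : Set (SignedMeasure 𝓧) :=
  {Q | Q ≪ᵥ P.toENNRealVectorMeasure ∧ Q univ = 1 ∧
    ∀ i, Integrable (g i) Q.totalVariation ∧ ∫ᵛ x, g i x ∂<•Q = 0}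

/-- There is a `φ`-projection `Qs` of `P` on `M_g` with the same support as `P`, that is,
`dQs/dP > 0` holds `P`-almost everywhere. -/
def ExistsProjectionSameSupport {l : ℕ} (φ : ℝ → ℝ≥0∞) (g : Fin l → 𝓧 → ℝ)
    (P : Measure 𝓧) : Prop :=
  ∃ Qs : SignedMeasure 𝓧,
    IsProjection φ (constraintSet g P) P Qs ∧ ∀ᵐ x ∂P, 0 < Qs.rnDeriv P x

/-- `φ(x) / |x| → ∞` as `|x| → ∞`. -/
def SuperlinearGrowth (φ : ℝ → ℝ≥0∞) : Prop :=
  Tendsto (fun x : ℝ => φ x / ENNReal.ofReal |x|) (Bornology.cobounded ℝ) (𝓝 ⊤)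

/-- `∫ φ^*(α |g_i|) dP < ∞` for all `α > 0` and all `i`.  (Here `φ^* ≥ 0` on `[0, ∞)`, since
`φ^*(t) ≥ t - φ(1) = t`, so that `toENNReal` does not truncate.) -/
def ConjugateIntegrable {l : ℕ} (φ : ℝ → ℝ≥0∞) (g : Fin l → 𝓧 → ℝ) (P : Measure 𝓧) : Prop :=
  ∀ α : ℝ, 0 < α → ∀ i, ∫⁻ x, (conjugate φ (α * |g i x|)).toENNReal ∂P < ⊤

/-- There are conjugate exponents `1 < r, k < ∞` with `liminf_{|x| → ∞} φ(x) / |x|^r > 0` and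
`g_i ∈ L_k(P)` for all `i`. -/
def PowerGrowthMoments {l : ℕ} (φ : ℝ → ℝ≥0∞) (g : Fin l → 𝓧 → ℝ) (P : Measure 𝓧) : Prop :=
  ∃ r k : ℝ, 1 < r ∧ 1 < k ∧ r⁻¹ + k⁻¹ = 1 ∧
    0 < liminf (fun x : ℝ => φ x / ENNReal.ofReal (|x| ^ r)) (Bornology.cobounded ℝ) ∧
    ∀ i, MemLp (g i) (ENNReal.ofReal k) P

/-- `g_1, …, g_l` belong to `L_∞(P)`. -/
def EssBounded {l : ℕ} (g : Fin l → 𝓧 → ℝ) (P : Measure 𝓧) : Prop :=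
  ∀ i, MemLp (g i) ⊤ P

/-- `φ` is differentiable, `a_φ = 0` and `φ'(0) = lim_{x ↓ 0} φ'(x) = -∞`. -/
def SteepAtZero (φ : ℝ → ℝ≥0∞) : Prop :=
  DifferentiableOnDomain φ ∧ leftEnd φ = 0 ∧
    Tendsto (deriv fun y => (φ y).toReal) (𝓝[>] (0 : ℝ)) atBot

/-- Some `Q₀ ∈ M_g` with `φ(Q₀, P) < ∞` satisfies `dQ₀/dP > 0`, `P`-almost everywhere. -/
def ExistsPositiveFeasible {l : ℕ} (φ : ℝ → ℝ≥0∞) (g : Fin l → 𝓧 → ℝ) (P : Measure 𝓧) : Prop :=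
  ∃ Q₀ ∈ constraintSet g P, divergence φ Q₀ P < ⊤ ∧ ∀ᵐ x ∂P, 0 < Q₀.rnDeriv P x

end

end PhiDivergence

open PhiDivergence

/-! Convexity under (F), and `leftEnd φ = 0` under (G), make `φ` infinite on the negative half-line.
Competitors of finite divergence are thus nonnegative densities `f`, and the task is to minimize `J
f = ∫ φ(f) dP` under linear constraints.

The growth and moment conditions serve only to give `IsDominated` for the functions `1, g_1, …,
g_l`. Since `ε` is arbitrary there, the products `h f` are uniformly integrable over densities with
bounded `J`, and the constraints survive a.e. limits (`IsFeasible.of_tendsto`). Such limits come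
from convexity (`exists_seq_tendsto_ae_of_midpoint_convex`): in the decreasing convex sets of near
minimizers of `J`, near minimizers of the strictly convex functional `∫ exp(-f) dP` have an a.e.
convergent subsequence. Fatou and lower semicontinuity make its limit a minimizer
(`exists_isFeasible_minimizer`).

If `φ 0 = ∞`, finiteness of `J f` gives `f > 0` a.e. In the steep case, moving from `f` towards a
positive feasible `f₀` would lower `J` at an infinite rate if `f` vanished on a set of positive
measure (`ae_pos_of_steep`). -/

namespace PhiDivergence

/-! ### Signed measures and their densities -/

section Density

variable {𝓧 : Type*} [MeasurableSpace 𝓧] {P : Measure 𝓧}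

lemma rnDeriv_withDensityᵥ_ae_eq [SigmaFinite P] {f : 𝓧 → ℝ} (hf : Integrable f P) :
    SignedMeasure.rnDeriv (P.withDensityᵥ f) P =ᵐ[P] f :=
  (SignedMeasure.integrable_rnDeriv _ _).ae_eq_of_withDensityᵥ_eq hf
    ((SignedMeasure.absolutelyContinuous_iff_withDensityᵥ_rnDeriv_eq _ _).1
      (P.withDensityᵥ_absolutelyContinuous f))

lemma divergence_withDensityᵥ [SigmaFinite P] (φ : ℝ → ℝ≥0∞) {f : 𝓧 → ℝ} (hf : Integrable f P) :
    divergence φ (P.withDensityᵥ f) P = ∫⁻ x, φ (f x) ∂P := by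
  rw [divergence, if_pos (P.withDensityᵥ_absolutelyContinuous f)]
  refine lintegral_congr_ae ?_
  filter_upwards [rnDeriv_withDensityᵥ_ae_eq hf] with x hx
  rw [hx]

/-- `f` is a nonnegative measurable function with `∫ h_j f dP = c_j` for all `j`. -/
structure IsFeasible {ι : Type*} (h : ι → 𝓧 → ℝ) (c : ι → ℝ) (P : Measure 𝓧) (f : 𝓧 → ℝ) :
    Prop where
  measurable : Measurable f
  nonneg : ∀ x, 0 ≤ f x
  integrable : ∀ j, Integrable (fun x => h j x * f x) P
  integral_eq : ∀ j, ∫ x, h j x * f x ∂P = c j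

lemma IsFeasible.convexComb {ι : Type*} {h : ι → 𝓧 → ℝ} {c : ι → ℝ} {f₁ f₂ : 𝓧 → ℝ}
    (h₁ : IsFeasible h c P f₁) (h₂ : IsFeasible h c P f₂) {s : ℝ} (hs₀ : 0 ≤ s) (hs₁ : s ≤ 1) :
    IsFeasible h c P (fun x => (1 - s) * f₁ x + s * f₂ x) := by
  have key : ∀ j, (fun x => h j x * ((1 - s) * f₁ x + s * f₂ x)) =
      fun x => (1 - s) * (h j x * f₁ x) + s * (h j x * f₂ x) := fun j => by
    funext x; ring
  refine ⟨(h₁.measurable.const_mul _).add (h₂.measurable.const_mul _), fun x => ?_,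
    fun j => ?_, fun j => ?_⟩
  · have := h₁.nonneg x
    have := h₂.nonneg x
    have : 0 ≤ 1 - s := by linarith
    positivity
  · rw [key]
    exact ((h₁.integrable j).const_mul _).add ((h₂.integrable j).const_mul _)
  · rw [key, integral_add ((h₁.integrable j).const_mul _) ((h₂.integrable j).const_mul _),
      integral_const_mul, integral_const_mul, h₁.integral_eq, h₂.integral_eq]
    ring

/-- The constraint functions `1, g_1, …, g_l`. -/
def withOne {l : ℕ} (g : Fin l → 𝓧 → ℝ) : Option (Fin l) → 𝓧 → ℝ
  | none => fun _ => 1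
  | some i => g i

/-- The values prescribed for the integrals of `1, g_1, …, g_l`. -/
def massOne (l : ℕ) : Option (Fin l) → ℝ
  | none => 1
  | some _ => 0

lemma IsFeasible.integrable_self {l : ℕ} {g : Fin l → 𝓧 → ℝ} {f : 𝓧 → ℝ}
    (hf : IsFeasible (withOne g) (massOne l) P f) : Integrable f P := by
  simpa [withOne] using hf.integrable none

/-- A nonnegative density defines a positive measure, which is its own total variation, so all
conditions become ordinary integrals against `P`. -/
lemma withDensityᵥ_mem_constraintSet_iff {l : ℕ} {g : Fin l → 𝓧 → ℝ} {f : 𝓧 → ℝ}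
    (hm : Measurable f) (h0 : ∀ x, 0 ≤ f x) (hi : Integrable f P) :
    P.withDensityᵥ f ∈ constraintSet g P ↔ IsFeasible (withOne g) (massOne l) P f := by
  have hm' : Measurable fun x => ENNReal.ofReal (f x) := hm.ennreal_ofReal
  have hfin : ∫⁻ x, ENNReal.ofReal (f x) ∂P ≠ ⊤ := hi.lintegral_lt_top.ne
  have htop : ∀ᵐ x ∂P, ENNReal.ofReal (f x) < ⊤ := ae_of_all _ fun x => ENNReal.ofReal_lt_top
  have : IsFiniteMeasure (P.withDensity fun x => ENNReal.ofReal (f x)) :=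
    isFiniteMeasure_withDensity hfin
  have heq : P.withDensityᵥ f =
      (P.withDensity fun x => ENNReal.ofReal (f x)).toSignedMeasure := by
    have := withDensityᵥ_toReal hm'.aemeasurable hfin
    simpa only [ENNReal.toReal_ofReal (h0 _)] using this
  have huniv : P.withDensityᵥ f univ = ∫ x, f x ∂P := by
    rw [withDensityᵥ_apply hi MeasurableSet.univ, setIntegral_univ]
  have hint : ∀ i, Integrable (g i) (SignedMeasure.totalVariation (P.withDensityᵥ f)) ↔
      Integrable (fun x => g i x * f x) P := fun i => by
    rw [SignedMeasure.totalVariation_eq_variation, heq, Measure.variation_toSignedMeasure,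
      integrable_withDensity_iff hm' htop]
    simp only [ENNReal.toReal_ofReal (h0 _)]
  have hval : ∀ i, ∫ᵛ x, g i x ∂<•(P.withDensityᵥ f) = ∫ x, g i x * f x ∂P := fun i => by
    rw [heq, VectorMeasure.integral_toSignedMeasure,
      integral_withDensity_eq_integral_toReal_smul hm' htop]
    simp only [ENNReal.toReal_ofReal (h0 _), smul_eq_mul, mul_comm]
  constructor
  · rintro ⟨-, hu, hg⟩
    refine ⟨hm, h0, ?_, ?_⟩
    · rintro (_ | i)
      · simpa [withOne] using hi
      · exact (hint i).1 (hg i).1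
    · rintro (_ | i)
      · simpa [withOne, massOne] using huniv.symm.trans hu
      · exact (hval i).symm.trans (hg i).2
  · intro hf
    refine ⟨P.withDensityᵥ_absolutelyContinuous f, ?_, fun i => ⟨(hint i).2 ?_, ?_⟩⟩
    · simpa [withOne, massOne] using huniv.trans (by simpa [withOne, massOne] using hf.integral_eq none)
    · exact hf.integrable (some i)
    · exact (hval i).trans (hf.integral_eq (some i))

/-- If `φ` is infinite on the negative half-line, the members of `constraintSet g P` of finite
divergence have feasible densities. -/
lemma exists_isFeasible_of_mem [SigmaFinite P] {φ : ℝ → ℝ≥0∞} (hφm : Measurable φ) (hneg : ∀ x < 0, φ x = ⊤)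
    {l : ℕ} {g : Fin l → 𝓧 → ℝ} {Q : SignedMeasure 𝓧} (hQ : Q ∈ constraintSet g P)
    (hfin : divergence φ Q P < ⊤) :
    ∃ f, IsFeasible (withOne g) (massOne l) P f ∧ Q = P.withDensityᵥ f ∧
      Q.rnDeriv P =ᵐ[P] f ∧ ∫⁻ x, φ (f x) ∂P = divergence φ Q P := by
  have hQeq := (SignedMeasure.absolutelyContinuous_iff_withDensityᵥ_rnDeriv_eq Q P).1 hQ.1
  have hm := SignedMeasure.measurable_rnDeriv Q P
  have hi := SignedMeasure.integrable_rnDeriv Q P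
  have hae : Q.rnDeriv P =ᵐ[P] fun x => max (Q.rnDeriv P x) 0 := by
    rw [divergence, if_pos hQ.1] at hfin
    filter_upwards [ae_lt_top (hφm.comp hm) hfin.ne] with x hx
    refine (max_eq_left (not_lt.1 fun h => ?_)).symm
    simp [hneg _ h] at hx
  have hi' := hi.congr hae
  have hQ' : Q = P.withDensityᵥ fun x => max (Q.rnDeriv P x) 0 := by
    rw [← WithDensityᵥEq.congr_ae hae, hQeq]
  refine ⟨_, (withDensityᵥ_mem_constraintSet_iff (hm.max measurable_const)
    (fun x => le_max_right _ _) hi').1 (hQ' ▸ hQ), hQ', hae, ?_⟩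
  conv_rhs => rw [hQ']
  exact (divergence_withDensityᵥ φ hi').symm

end Density

/-! ### Growth and conjugate of `φ` -/

section Scalar

variable {φ : ℝ → ℝ≥0∞}

lemma IsDivergenceFunction.le_combination (hφ : IsDivergenceFunction φ) (x y : ℝ) {s : ℝ}
    (hs₀ : 0 ≤ s) (hs₁ : s ≤ 1) :
    φ ((1 - s) * x + s * y) ≤ ENNReal.ofReal (1 - s) * φ x + ENNReal.ofReal s * φ y := by
  have hs' : 0 ≤ 1 - s := by linarith
  have := hφ.convex.2 (mem_univ x) (mem_univ y) (zero_le (a := Real.toNNReal (1 - s)))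
    (zero_le (a := Real.toNNReal s)) (by rw [← Real.toNNReal_add hs' hs₀]; simp)
  simpa [NNReal.smul_def, ENNReal.smul_def, hs', hs₀, ENNReal.ofReal] using this

/-- The point 0 lies between `x` and 1, and `φ 1 = 0`, so a finite `φ x` would make `φ 0` finite. -/
lemma IsDivergenceFunction.eq_top_of_neg_of_map_zero (hφ : IsDivergenceFunction φ)
    (h0 : φ 0 = ⊤) {x : ℝ} (hx : x < 0) : φ x = ⊤ := by
  by_contra hne
  have h1x : 0 < 1 - x := by linarith
  have := hφ.le_combination 1 x (s := 1 / (1 - x)) (by positivity)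
    ((div_le_one h1x).2 (by linarith))
  rw [hφ.map_one, mul_zero, zero_add,
    show (1 - 1 / (1 - x)) * 1 + 1 / (1 - x) * x = 0 by field_simp; ring, h0, top_le_iff] at this
  exact ENNReal.mul_ne_top ENNReal.ofReal_ne_top hne this

lemma eq_top_of_neg_of_leftEnd (h : leftEnd φ = 0) {x : ℝ} (hx : x < 0) : φ x = ⊤ := by
  by_contra hne
  have : leftEnd φ ≤ (x : EReal) := sInf_le ⟨x, lt_top_iff_ne_top.2 hne, rfl⟩
  rw [h] at this
  exact absurd (EReal.coe_nonneg.1 this) (not_le.2 hx)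

lemma le_add_mul_of_superlinearGrowth (hB : SuperlinearGrowth φ) {ε : ℝ} (hε : 0 < ε) :
    ∃ M : ℝ, 0 ≤ M ∧ ∀ x, 0 ≤ x → ENNReal.ofReal x ≤ ENNReal.ofReal M + ENNReal.ofReal ε * φ x := by
  have h1 : ∀ᶠ x in Bornology.cobounded ℝ, ENNReal.ofReal ε⁻¹ < φ x / ENNReal.ofReal |x| :=
    hB.eventually (lt_mem_nhds ENNReal.ofReal_lt_top)
  rw [IsOrderBornology.cobounded_eq, eventually_sup] at h1
  obtain ⟨M, hM⟩ := eventually_atTop.1 h1.2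
  refine ⟨max M 0, le_max_right _ _, fun x hx => ?_⟩
  by_cases hxM : x ≤ max M 0
  · exact (ENNReal.ofReal_le_ofReal hxM).trans le_self_add
  · push Not at hxM
    have h0 : 0 < x := (le_max_right _ _).trans_lt hxM
    have h2 := (hM x ((le_max_left _ _).trans hxM.le)).le
    rw [abs_of_pos h0, ENNReal.le_div_iff_mul_le (by simp [h0]) (by simp)] at h2
    refine le_add_left ?_
    calc ENNReal.ofReal x = ENNReal.ofReal ε * (ENNReal.ofReal ε⁻¹ * ENNReal.ofReal x) := by
          rw [← ENNReal.ofReal_mul (by positivity), ← ENNReal.ofReal_mul hε.le,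
            mul_inv_cancel_left₀ hε.ne']
      _ ≤ _ := by gcongr

lemma le_add_mul_of_powerGrowth {r : ℝ} (hr : 0 < r)
    (h : 0 < liminf (fun x : ℝ => φ x / ENNReal.ofReal (|x| ^ r)) (Bornology.cobounded ℝ)) :
    ∃ M c : ℝ, 0 ≤ M ∧ 0 < c ∧ ∀ x, 0 ≤ x →
      ENNReal.ofReal (x ^ r) ≤ ENNReal.ofReal M + ENNReal.ofReal c * φ x := by
  obtain ⟨a, ha0, ha⟩ := exists_between h
  have h1 := eventually_lt_of_lt_liminf ha
  rw [IsOrderBornology.cobounded_eq, eventually_sup] at h1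
  obtain ⟨M, hM⟩ := eventually_atTop.1 h1.2
  have hat : a ≠ ⊤ := ha.ne_top
  have har : 0 < a.toReal := ENNReal.toReal_pos ha0.ne' hat
  refine ⟨(max M 0) ^ r, a.toReal⁻¹, by positivity, by positivity, fun x hx => ?_⟩
  by_cases hxM : x ≤ max M 0
  · exact (ENNReal.ofReal_le_ofReal (Real.rpow_le_rpow hx hxM hr.le)).trans le_self_add
  · push Not at hxM
    have h0 : 0 < x := (le_max_right _ _).trans_lt hxM
    have h2 := (hM x ((le_max_left _ _).trans hxM.le)).le
    have hxr : 0 < x ^ r := Real.rpow_pos_of_pos h0 r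
    rw [abs_of_pos h0, ENNReal.le_div_iff_mul_le (by simp [hxr]) (by simp)] at h2
    refine le_add_left ?_
    rw [ENNReal.ofReal_inv_of_pos har, ENNReal.ofReal_toReal hat]
    calc ENNReal.ofReal (x ^ r) = a⁻¹ * (a * ENNReal.ofReal (x ^ r)) := by
          rw [← mul_assoc, ENNReal.inv_mul_cancel ha0.ne' hat, one_mul]
      _ ≤ _ := by gcongr

/-- Only `x ≥ 0` contributes to the supremum, and there `t * x` increases with `t`. This supplies
the measurability of `φ^*(α |g_i|)`. -/
lemma monotone_conjugate (hneg : ∀ x < 0, φ x = ⊤) : Monotone (conjugate φ) := by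
  intro s t hst
  refine iSup_mono fun x => ?_
  rcases lt_or_ge x 0 with hx | hx
  · simp [hneg x hx]
  · exact EReal.sub_le_sub (EReal.coe_le_coe_iff.2 (mul_le_mul_of_nonneg_right hst hx)) le_rfl

/-- The Fenchel–Young inequality, with negative values truncated to 0. -/
lemma ofReal_mul_le_add_conjugate (t x : ℝ) :
    ENNReal.ofReal (t * x) ≤ φ x + (conjugate φ t).toENNReal := by
  rcases eq_or_ne (φ x) ⊤ with hx | hx
  · simp [hx]
  have h1 : ((t * x : ℝ) : EReal) - (φ x : EReal) ≤ conjugate φ t :=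
    le_iSup (fun x : ℝ => ((t * x : ℝ) : EReal) - (φ x : EReal)) x
  have h2 := EReal.toENNReal_le_toENNReal h1
  have h3 : ENNReal.ofReal (t * x - (φ x).toReal) ≤ (conjugate φ t).toENNReal := by
    refine le_trans (le_of_eq ?_) h2
    rw [← EReal.coe_ennreal_toReal hx, ← EReal.coe_sub,
      EReal.toENNReal_of_ne_top (EReal.coe_ne_top _),
      EReal.toReal_coe]
  calc ENNReal.ofReal (t * x) = ENNReal.ofReal ((φ x).toReal + (t * x - (φ x).toReal)) := by
        congr 1; ring
    _ ≤ ENNReal.ofReal (φ x).toReal + ENNReal.ofReal (t * x - (φ x).toReal) :=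
        ENNReal.ofReal_add_le
    _ ≤ _ := by rw [ENNReal.ofReal_toReal hx]; gcongr

end Scalar

/-! ### Domination of the constraint functions -/

section Domination

variable {𝓧 : Type*} [MeasurableSpace 𝓧] {P : Measure 𝓧}
  {φ : ℝ → ℝ≥0∞}

/-- For every `ε > 0`, `|h ω| x` is at most `ε φ(x)` up to an integrable function of `ω`. -/
def IsDominated (φ : ℝ → ℝ≥0∞) (h : 𝓧 → ℝ) (P : Measure 𝓧) : Prop :=
  ∀ ε : ℝ, 0 < ε → ∃ k : 𝓧 → ℝ, Integrable k P ∧ (∀ ω, 0 ≤ k ω) ∧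
    ∀ᵐ ω ∂P, ∀ x, 0 ≤ x → ENNReal.ofReal (|h ω| * x) ≤ ENNReal.ofReal (k ω) + ENNReal.ofReal ε * φ x

lemma isDominated_of_memLp_top [IsFiniteMeasure P] (hB : SuperlinearGrowth φ) {h : 𝓧 → ℝ} (hh : MemLp h ⊤ P) :
    IsDominated φ h P := by
  intro ε hε
  obtain ⟨G, hG0, hG⟩ : ∃ G : ℝ, 0 < G ∧ ∀ᵐ ω ∂P, |h ω| ≤ G := by
    refine ⟨(eLpNormEssSup h P).toReal + 1, by positivity, ?_⟩
    have hfin : eLpNormEssSup h P ≠ ⊤ := by simpa using hh.2.ne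
    filter_upwards [enorm_ae_le_eLpNormEssSup h P] with ω hω
    have := ENNReal.toReal_mono hfin hω
    rw [toReal_enorm, Real.norm_eq_abs] at this
    linarith
  obtain ⟨M, hM0, hM⟩ := le_add_mul_of_superlinearGrowth hB (ε := ε / G) (by positivity)
  refine ⟨fun _ => G * M, integrable_const _, fun _ => by positivity, ?_⟩
  filter_upwards [hG] with ω hω x hx
  calc ENNReal.ofReal (|h ω| * x) ≤ ENNReal.ofReal (G * x) := by gcongr
    _ = ENNReal.ofReal G * ENNReal.ofReal x := ENNReal.ofReal_mul hG0.le
    _ ≤ ENNReal.ofReal G * (ENNReal.ofReal M + ENNReal.ofReal (ε / G) * φ x) := by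
        gcongr; exact hM x hx
    _ = _ := by
        rw [mul_add, ← mul_assoc, ← ENNReal.ofReal_mul hG0.le, ← ENNReal.ofReal_mul hG0.le,
          mul_div_cancel₀ _ hG0.ne']

/-- Fenchel–Young at `t = |h| / ε`, multiplied by `ε`; small `ε` calls for large `α` in (C). -/
lemma isDominated_of_conjugate (hneg : ∀ x < 0, φ x = ⊤) {h : 𝓧 → ℝ} (hm : Measurable h)
    (hC : ∀ α : ℝ, 0 < α → ∫⁻ x, (conjugate φ (α * |h x|)).toENNReal ∂P < ⊤) :
    IsDominated φ h P := by
  intro ε hε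
  have hmeas : Measurable fun ω => (conjugate φ (ε⁻¹ * |h ω|)).toENNReal :=
    ((monotone_conjugate hneg).measurable.comp
      ((continuous_abs.measurable.comp hm).const_mul _)).ereal_toENNReal
  have hfin := hC ε⁻¹ (by positivity)
  refine ⟨fun ω => ε * (conjugate φ (ε⁻¹ * |h ω|)).toENNReal.toReal,
    (integrable_toReal_of_lintegral_ne_top hmeas.aemeasurable hfin.ne).const_mul _,
    fun _ => by positivity, ?_⟩
  filter_upwards [ae_lt_top hmeas hfin.ne] with ω hω x hx
  rw [ENNReal.ofReal_mul hε.le, ENNReal.ofReal_toReal hω.ne, ← mul_add, add_comm]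
  calc ENNReal.ofReal (|h ω| * x) = ENNReal.ofReal ε * ENNReal.ofReal (ε⁻¹ * |h ω| * x) := by
        rw [← ENNReal.ofReal_mul hε.le, mul_assoc, mul_inv_cancel_left₀ hε.ne']
    _ ≤ _ := by gcongr; exact ofReal_mul_le_add_conjugate _ _

lemma isDominated_of_powerGrowth [IsFiniteMeasure P] {r k : ℝ} (hr : 1 < r) (hk : 1 < k) (hrk : r⁻¹ + k⁻¹ = 1)
    (hφ : 0 < liminf (fun x : ℝ => φ x / ENNReal.ofReal (|x| ^ r)) (Bornology.cobounded ℝ))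
    {h : 𝓧 → ℝ} (hh : MemLp h (ENNReal.ofReal k) P) : IsDominated φ h P := by
  intro ε hε
  have hr0 : 0 < r := by linarith
  have hk0 : 0 < k := by linarith
  obtain ⟨M, c, hM0, hc0, hM⟩ := le_add_mul_of_powerGrowth hr0 hφ
  -- Young's inequality will be applied to `(|h| / δ) * (δ x)`; this `δ` turns `(δ x) ^ r` into `(ε
  -- / c) x ^ r`, and the growth bound turns that into `ε φ x` plus a constant.
  obtain ⟨δ, hδ0, hδ⟩ : ∃ δ : ℝ, 0 < δ ∧ δ ^ r = ε / c :=
    ⟨(ε / c) ^ r⁻¹, by positivity, Real.rpow_inv_rpow (by positivity) hr0.ne'⟩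
  have hint : Integrable (fun ω => (|h ω|) ^ k) P := by
    simpa [hk0.le] using hh.integrable_norm_rpow (by simpa using hk0) (by simp)
  refine ⟨fun ω => (δ⁻¹) ^ k * |h ω| ^ k + ε / c * M, (hint.const_mul _).add (integrable_const _),
    fun ω => by positivity, ae_of_all _ fun ω x hx => ?_⟩
  have hconj : k.HolderConjugate r := by
    rw [Real.holderConjugate_iff]; exact ⟨hk, by rw [add_comm]; exact hrk⟩
  have hyoung : |h ω| * x ≤ (δ⁻¹) ^ k * |h ω| ^ k + ε / c * x ^ r := by
    have h1 := Real.young_inequality_of_nonneg (a := δ⁻¹ * |h ω|) (b := δ * x) (by positivity)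
      (by positivity) hconj
    have h2 : (δ⁻¹ * |h ω|) ^ k / k ≤ (δ⁻¹ * |h ω|) ^ k := div_le_self (by positivity) hk.le
    have h3 : (δ * x) ^ r / r ≤ (δ * x) ^ r := div_le_self (by positivity) hr.le
    rw [Real.mul_rpow (by positivity) (by positivity)] at h2
    rw [Real.mul_rpow hδ0.le hx, hδ] at h3
    have h4 : δ⁻¹ * |h ω| * (δ * x) = |h ω| * x := by field_simp
    rw [Real.mul_rpow (by positivity) (by positivity), Real.mul_rpow hδ0.le hx, hδ, h4] at h1
    linarith
  calc ENNReal.ofReal (|h ω| * x)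
      ≤ ENNReal.ofReal ((δ⁻¹) ^ k * |h ω| ^ k) + ENNReal.ofReal (ε / c) * ENNReal.ofReal (x ^ r) := by
        rw [← ENNReal.ofReal_mul (by positivity), ← ENNReal.ofReal_add (by positivity) (by positivity)]
        exact ENNReal.ofReal_le_ofReal hyoung
    _ ≤ ENNReal.ofReal ((δ⁻¹) ^ k * |h ω| ^ k) +
        ENNReal.ofReal (ε / c) * (ENNReal.ofReal M + ENNReal.ofReal c * φ x) := by
        gcongr; exact hM x hx
    _ = _ := by
        rw [ENNReal.ofReal_add (by positivity) (by positivity), mul_add, ← mul_assoc,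
          ← ENNReal.ofReal_mul (by positivity), ← ENNReal.ofReal_mul (by positivity),
          div_mul_cancel₀ _ hc0.ne', add_assoc]

end Domination

end PhiDivergence

namespace PhiDivergence

/-! ### Almost everywhere convergence from convexity -/

section Compactness

variable {𝓧 : Type*} [MeasurableSpace 𝓧] {P : Measure 𝓧} [IsProbabilityMeasure P]

/-- The limit `b = 0` would force `v → ∞`, which the finite liminf excludes; otherwise take
logarithms. The maximum with 0 makes the limit formula nonnegative for every real `b`. -/
lemma tendsto_of_tendsto_exp_neg_half {v : ℕ → ℝ} (hv : ∀ n, 0 ≤ v n) {b : ℝ}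
    (hb : Tendsto (fun n => Real.exp (-(v n) / 2)) atTop (𝓝 b))
    (hfin : liminf (fun n => ENNReal.ofReal (v n)) atTop < ⊤) :
    Tendsto v atTop (𝓝 (max 0 (-2 * Real.log b))) := by
  have hb0 : 0 ≤ b := ge_of_tendsto' hb fun n => (Real.exp_pos _).le
  rcases hb0.eq_or_lt with rfl | hbpos
  · exfalso
    have h1 := Real.tendsto_exp_comp_nhds_zero.1 hb
    have h2 : Tendsto v atTop atTop := by
      have h := h1.const_mul_atBot_of_neg (show (-2 : ℝ) < 0 by norm_num)
      refine h.congr fun n => by ring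
    have h3 := (ENNReal.tendsto_ofReal_atTop.comp h2).liminf_eq
    exact hfin.ne h3
  · have h1 := ((Real.continuousAt_log hbpos.ne').tendsto.comp hb).const_mul (-2)
    have h2 : Tendsto v atTop (𝓝 (-2 * Real.log b)) := by
      refine h1.congr fun n => ?_
      simp only [Function.comp_apply, Real.log_exp]
      ring
    rwa [max_eq_right (ge_of_tendsto' h2 hv)]

/-- From a decreasing sequence of midpoint convex sets of nonnegative functions bounded in `L¹`
one can select a sequence of functions that converges almost everywhere. -/
lemma exists_seq_tendsto_ae_of_midpoint_convex {K : ℕ → Set (𝓧 → ℝ)} (hanti : Antitone K)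
    (hne : ∀ n, (K n).Nonempty) (hmeas : ∀ f ∈ K 0, Measurable f)
    (hnn : ∀ f ∈ K 0, ∀ x, 0 ≤ f x) {C : ℝ≥0∞} (hC : C ≠ ⊤)
    (hbd : ∀ f ∈ K 0, ∫⁻ x, ENNReal.ofReal (f x) ∂P ≤ C)
    (hmid : ∀ n, ∀ f₁ ∈ K n, ∀ f₂ ∈ K n, (fun x => (1 - 1 / 2) * f₁ x + 1 / 2 * f₂ x) ∈ K n) :
    ∃ (u : ℕ → 𝓧 → ℝ) (f : 𝓧 → ℝ), Measurable f ∧ (∀ x, 0 ≤ f x) ∧ (∀ n, u n ∈ K n) ∧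
      ∀ᵐ x ∂P, Tendsto (fun n => u n x) atTop (𝓝 (f x)) := by
  have h0 : ∀ n, K n ⊆ K 0 := fun n => hanti (Nat.zero_le n)
  set W : (𝓧 → ℝ) → ℝ := fun f => ∫ x, Real.exp (-f x) ∂P with hW
  have hWint : ∀ f ∈ K 0, Integrable (fun x => Real.exp (-f x)) P := fun f hf =>
    Integrable.of_bound (Real.measurable_exp.comp (hmeas f hf).neg).aestronglyMeasurable 1
      (ae_of_all _ fun x => by simpa using hnn f hf x)
  have hW0 : ∀ f, 0 ≤ W f := fun f => integral_nonneg fun x => (Real.exp_pos _).le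
  have hW1 : ∀ f ∈ K 0, W f ≤ 1 := fun f hf => by
    have := integral_mono (hWint f hf) (integrable_const (1 : ℝ))
      (fun x => by simpa using hnn f hf x)
    simpa using this
  have hbdd : ∀ n, BddBelow (W '' K n) := fun n => ⟨0, by rintro _ ⟨f, -, rfl⟩; exact hW0 f⟩
  set w : ℕ → ℝ := fun n => sInf (W '' K n) with hw
  have hwmono : Monotone w := fun n m hnm =>
    csInf_le_csInf (hbdd n) ((hne m).image _) (image_mono (hanti hnm))
  have hw1 : ∀ n, w n ≤ 1 := fun n => by
    obtain ⟨f, hf⟩ := hne n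
    exact (csInf_le (hbdd n) ⟨f, hf, rfl⟩).trans (hW1 f (h0 n hf))
  have hwbdd : BddAbove (range w) := ⟨1, by rintro _ ⟨n, rfl⟩; exact hw1 n⟩
  have hwlim := tendsto_atTop_ciSup hwmono hwbdd
  have hwle : ∀ n, w n ≤ ⨆ n, w n := le_ciSup hwbdd
  have hex : ∀ n : ℕ, ∃ f ∈ K n, W f < w n + 1 / (n + 1 : ℝ) := fun n => by
    obtain ⟨_, ⟨f, hf, rfl⟩, h⟩ := exists_lt_of_csInf_lt ((hne n).image W)
      (show sInf (W '' K n) < w n + 1 / (n + 1 : ℝ) from lt_add_of_pos_right _ (by positivity))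
    exact ⟨f, hf, h⟩
  choose v hvK hvW using hex
  have hv0 : ∀ n, v n ∈ K 0 := fun n => h0 n (hvK n)
  set a : ℕ → 𝓧 → ℝ := fun n x => Real.exp (-(v n x) / 2) with ha
  have ham : ∀ n, Measurable (a n) := fun n =>
    Real.measurable_exp.comp ((hmeas _ (hv0 n)).neg.div_const 2)
  have haL : ∀ n, MemLp (a n) 2 P := fun n =>
    MemLp.of_bound (ham n).aestronglyMeasurable 1 (ae_of_all _ fun x => by
      have := hnn _ (hv0 n) x
      simp only [ha, Real.norm_eq_abs, Real.abs_exp, Real.exp_le_one_iff]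
      linarith)
  -- For indices at least `N`, each of two near minimizers has `W` at most `⨆ n, w n` plus `1 / (N +
  -- 1)`, while their midpoint lies in `K N` and has `W` at least `w N`.
  set B : ℕ → ℝ := fun N => 2 * ((⨆ n, w n) - w N) + 2 * (1 / (N + 1 : ℝ)) with hB
  have hBlim : Tendsto B atTop (𝓝 0) := by
    have := ((hwlim.const_sub (⨆ n, w n)).const_mul 2).add
      ((tendsto_one_div_add_atTop_nhds_zero_nat (𝕜 := ℝ)).const_mul 2)
    simpa only [sub_self, mul_zero, add_zero] using this
  have hest : ∀ n m N : ℕ, N ≤ n → N ≤ m → ∫ x, (a n x - a m x) ^ 2 ∂P ≤ B N := by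
    intro n m N hn hm
    have hmidK := hmid N _ (hanti hn (hvK n)) _ (hanti hm (hvK m))
    have hle : w N ≤ W _ := csInf_le (hbdd N) ⟨_, hmidK, rfl⟩
    -- The cross term of the square is `exp(-·)` at the midpoint: this quantifies the strict
    -- convexity of `W`.
    have heq : ∀ x, (a n x - a m x) ^ 2 = Real.exp (-v n x) + Real.exp (-v m x) -
        2 * Real.exp (-((1 - 1 / 2) * v n x + 1 / 2 * v m x)) := fun x => by
      have e1 : Real.exp (-v n x) = a n x * a n x := by
        rw [ha, ← Real.exp_add]; congr 1; ring
      have e2 : Real.exp (-v m x) = a m x * a m x := by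
        rw [ha, ← Real.exp_add]; congr 1; ring
      have e3 : Real.exp (-((1 - 1 / 2) * v n x + 1 / 2 * v m x)) = a n x * a m x := by
        rw [ha, ← Real.exp_add]; congr 1; ring
      rw [e1, e2, e3]; ring
    simp only [heq]
    rw [integral_sub ((hWint _ (hv0 n)).fun_add (hWint _ (hv0 m))) ((hWint _ (h0 N hmidK)).const_mul 2),
      integral_add (hWint _ (hv0 n)) (hWint _ (hv0 m)), integral_const_mul]
    have h1 := hvW n
    have h2 := hvW m
    have h3 : 1 / (n + 1 : ℝ) ≤ 1 / (N + 1 : ℝ) := Nat.one_div_le_one_div hn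
    have h4 : 1 / (m + 1 : ℝ) ≤ 1 / (N + 1 : ℝ) := Nat.one_div_le_one_div hm
    have h5 := hwle n
    have h6 := hwle m
    simp only [hW] at h1 h2 hle
    simp only [hB]
    linarith
  have hcauchy : CauchySeq fun n => (haL n).toLp (a n) := by
    refine cauchySeq_of_le_tendsto_0 (fun N => (B N) ^ (2 : ℝ)⁻¹) (fun n m N hn hm => ?_) ?_
    · rw [dist_eq_norm, ← MemLp.toLp_sub, Lp.norm_toLp,
        MemLp.eLpNorm_eq_integral_rpow_norm (by norm_num) (by norm_num) ((haL n).sub (haL m)),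
        ENNReal.toReal_ofReal (by positivity)]
      have : ∀ x, ‖(a n - a m) x‖ ^ (2 : ℝ) = (a n x - a m x) ^ 2 := fun x => by simp
      simp only [ENNReal.toReal_ofNat, this]
      exact Real.rpow_le_rpow (integral_nonneg fun x => sq_nonneg (a n x - a m x))
        (hest n m N hn hm) (by norm_num)
    · have := hBlim.rpow_const (p := (2 : ℝ)⁻¹) (Or.inr (by norm_num))
      simpa using this
  obtain ⟨L, hL⟩ := cauchySeq_tendsto_of_complete hcauchy
  obtain ⟨ns, hns, hae⟩ := (tendstoInMeasure_of_tendsto_Lp hL).exists_seq_tendsto_ae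
  -- Since `n ≤ ns n` and `K` decreases, the subsequence still has its `n`-th term in `K n`.
  have hnsK : ∀ n, v (ns n) ∈ K n := fun n => hanti hns.le_apply (hvK (ns n))
  have hFatou : ∫⁻ x, liminf (fun n => ENNReal.ofReal (v (ns n) x)) atTop ∂P ≤ C :=
    (lintegral_liminf_le fun n => (hmeas _ (hv0 (ns n))).ennreal_ofReal).trans
      (liminf_le_of_le (by isBoundedDefault) fun b hb => by
        obtain ⟨n, hn⟩ := hb.exists
        exact hn.trans (hbd _ (hv0 _)))
  have hfin := ae_lt_top
    (Measurable.liminf fun n => (hmeas _ (hv0 (ns n))).ennreal_ofReal)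
    (hFatou.trans_lt hC.lt_top).ne
  have hrep : ∀ᵐ x ∂P, ∀ n, ((haL n).toLp (a n) : 𝓧 → ℝ) x = a n x :=
    ae_all_iff.2 fun n => (haL n).coeFn_toLp
  refine ⟨fun n => v (ns n), fun x => max 0 (-2 * Real.log (L x)),
    measurable_const.max ((Real.measurable_log.comp (Lp.stronglyMeasurable L).measurable).const_mul
      _), fun x => le_max_left _ _, hnsK, ?_⟩
  filter_upwards [hae, hfin, hrep] with x h1 h2 h3
  simp only [h3] at h1
  exact tendsto_of_tendsto_exp_neg_half (fun n => hnn _ (hv0 (ns n)) x) h1 h2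

end Compactness

/-! ### Existence and positivity of a minimizer -/

section Minimizer

variable {𝓧 : Type*} [MeasurableSpace 𝓧] {P : Measure 𝓧} {φ : ℝ → ℝ≥0∞}

/-- Clamping `F` to `[-k, k]` changes it by at most the positive part of `|F| - k`, which is at most
`ε Φ`. -/
lemma integrable_and_abs_integral_sub_clamp_le {F k : 𝓧 → ℝ} {Φ : 𝓧 → ℝ≥0∞} {ε C : ℝ}
    (hF : Measurable F) (hk : Integrable k P) (hk0 : ∀ x, 0 ≤ k x) (hε : 0 < ε) (hC : 0 ≤ C)
    (hΦ : ∫⁻ x, Φ x ∂P ≤ ENNReal.ofReal C)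
    (hle : ∀ᵐ x ∂P, ENNReal.ofReal |F x| ≤ ENNReal.ofReal (k x) + ENNReal.ofReal ε * Φ x) :
    Integrable F P ∧ |∫ x, F x ∂P - ∫ x, max (-k x) (min (k x) (F x)) ∂P| ≤ ε * C := by
  have hεΦ : ∫⁻ x, ENNReal.ofReal ε * Φ x ∂P ≤ ENNReal.ofReal (ε * C) := by
    rw [lintegral_const_mul' _ _ ENNReal.ofReal_ne_top, ENNReal.ofReal_mul hε.le]
    gcongr
  have hFi : Integrable F P := by
    refine ⟨hF.aestronglyMeasurable, ?_⟩
    calc ∫⁻ x, ‖F x‖ₑ ∂P ≤ ∫⁻ x, ENNReal.ofReal (k x) + ENNReal.ofReal ε * Φ x ∂P := by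
          refine lintegral_mono_ae ?_
          filter_upwards [hle] with x hx
          rwa [Real.enorm_eq_ofReal_abs]
      _ = ∫⁻ x, ENNReal.ofReal (k x) ∂P + ∫⁻ x, ENNReal.ofReal ε * Φ x ∂P :=
          lintegral_add_left' hk.aemeasurable.ennreal_ofReal _
      _ < ⊤ := ENNReal.add_lt_top.2 ⟨hk.lintegral_lt_top, hεΦ.trans_lt ENNReal.ofReal_lt_top⟩
  have hci : Integrable (fun x => max (-k x) (min (k x) (F x))) P := hk.neg.sup (hk.inf hFi)
  refine ⟨hFi, ?_⟩
  rw [← integral_sub hFi hci, ← Real.norm_eq_abs]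
  refine (norm_integral_le_lintegral_norm _).trans ?_
  refine ENNReal.toReal_le_of_le_ofReal (by positivity) (le_trans (lintegral_mono_ae ?_) hεΦ)
  filter_upwards [hle] with x hx
  have h1 : ‖F x - max (-k x) (min (k x) (F x))‖ ≤ max (|F x| - k x) 0 := by
    have := hk0 x
    rw [Real.norm_eq_abs]
    grind
  refine (ENNReal.ofReal_le_ofReal h1).trans ?_
  rw [ENNReal.ofReal_max, ENNReal.ofReal_zero, max_eq_left zero_le, ENNReal.ofReal_sub _ (hk0 x)]
  exact tsub_le_iff_left.2 hx

lemma IsDivergenceFunction.measurable (hφ : IsDivergenceFunction φ) : Measurable φ :=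
  hφ.closed.measurable

lemma IsDivergenceFunction.lintegral_combination_le (hφ : IsDivergenceFunction φ)
    {f₁ f₂ : 𝓧 → ℝ} (h₁ : Measurable f₁) {s : ℝ} (hs₀ : 0 ≤ s) (hs₁ : s ≤ 1) :
    ∫⁻ x, φ ((1 - s) * f₁ x + s * f₂ x) ∂P ≤
      ENNReal.ofReal (1 - s) * ∫⁻ x, φ (f₁ x) ∂P + ENNReal.ofReal s * ∫⁻ x, φ (f₂ x) ∂P := by
  rw [← lintegral_const_mul' _ _ ENNReal.ofReal_ne_top,
    ← lintegral_const_mul' _ _ ENNReal.ofReal_ne_top,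
    ← lintegral_add_left ((show Measurable fun x => φ (f₁ x) from hφ.measurable.comp h₁).const_mul _)]
  exact lintegral_mono fun x => hφ.le_combination _ _ hs₀ hs₁

lemma lintegral_le_liminf_of_tendsto (hφ : IsDivergenceFunction φ) {u : ℕ → 𝓧 → ℝ} {f : 𝓧 → ℝ}
    (hu : ∀ n, Measurable (u n)) (h : ∀ᵐ x ∂P, Tendsto (fun n => u n x) atTop (𝓝 (f x))) :
    ∫⁻ x, φ (f x) ∂P ≤ liminf (fun n => ∫⁻ x, φ (u n x) ∂P) atTop := by
  refine le_trans (lintegral_mono_ae ?_) (lintegral_liminf_le fun n => hφ.measurable.comp (hu n))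
  filter_upwards [h] with x hx
  exact (LowerSemicontinuousAt.le_liminf (hφ.closed (f x))).trans (liminf_le_liminf_of_le hx)

variable {ι : Type*} {h : ι → 𝓧 → ℝ} {c : ι → ℝ}

/-- If the constraint functions are dominated, the constraints pass to almost everywhere limits of
feasible densities of bounded divergence. -/
lemma IsFeasible.of_tendsto (hdom : ∀ j, IsDominated φ (h j) P) (hm : ∀ j, Measurable (h j))
    {u : ℕ → 𝓧 → ℝ} {f : 𝓧 → ℝ} (hu : ∀ n, IsFeasible h c P (u n)) (hfm : Measurable f)
    (hf0 : ∀ x, 0 ≤ f x) (hlim : ∀ᵐ x ∂P, Tendsto (fun n => u n x) atTop (𝓝 (f x)))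
    {C : ℝ} (hC : 0 ≤ C) (huC : ∀ n, ∫⁻ x, φ (u n x) ∂P ≤ ENNReal.ofReal C)
    (hfC : ∫⁻ x, φ (f x) ∂P ≤ ENNReal.ofReal C) : IsFeasible h c P f := by
  have key : ∀ j (ε : ℝ), 0 < ε →
      Integrable (fun x => h j x * f x) P ∧ |∫ x, h j x * f x ∂P - c j| ≤ 2 * (ε * C) := by
    intro j ε hε
    obtain ⟨k, hk, hk0, hkle⟩ := hdom j ε hε
    have hgen : ∀ q : 𝓧 → ℝ, Measurable q → (∀ x, 0 ≤ q x) →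
        ∫⁻ x, φ (q x) ∂P ≤ ENNReal.ofReal C → Integrable (fun x => h j x * q x) P ∧
        |∫ x, h j x * q x ∂P - ∫ x, max (-k x) (min (k x) (h j x * q x)) ∂P| ≤ ε * C := by
      intro q hq hq0 hqC
      refine integrable_and_abs_integral_sub_clamp_le ((hm j).mul hq) hk hk0 hε hC hqC ?_
      filter_upwards [hkle] with x hx
      rw [abs_mul, abs_of_nonneg (hq0 x)]
      exact hx _ (hq0 x)
    obtain ⟨hint, hfle⟩ := hgen f hfm hf0 hfC
    refine ⟨hint, ?_⟩
    -- The clamped integrands are bounded by the fixed integrable `k`, so dominated convergence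
    -- applies to them.
    have hT : Tendsto (fun n => ∫ x, max (-k x) (min (k x) (h j x * u n x)) ∂P) atTop
        (𝓝 (∫ x, max (-k x) (min (k x) (h j x * f x)) ∂P)) := by
      refine tendsto_integral_of_dominated_convergence k (fun n => ?_) hk (fun n => ?_) ?_
      · exact (hk.aestronglyMeasurable.neg).sup (hk.aestronglyMeasurable.inf
          ((hm j).mul (hu n).measurable).aestronglyMeasurable)
      · refine ae_of_all _ fun x => ?_
        have := hk0 x
        rw [Real.norm_eq_abs, abs_le]
        exact ⟨le_max_left _ _, max_le (by linarith) (min_le_left _ _)⟩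
      · filter_upwards [hlim] with x hx
        exact tendsto_const_nhds.max (tendsto_const_nhds.min (hx.const_mul _))
    have h2 : |c j - ∫ x, max (-k x) (min (k x) (h j x * f x)) ∂P| ≤ ε * C := by
      refine le_of_tendsto (hT.const_sub (c j)).abs (Eventually.of_forall fun n => ?_)
      have := (hgen (u n) (hu n).measurable (hu n).nonneg (huC n)).2
      rwa [(hu n).integral_eq j] at this
    rw [abs_le] at *
    constructor <;> linarith [hfle.1, hfle.2, h2.1, h2.2]
  refine ⟨hfm, hf0, fun j => (key j 1 one_pos).1, fun j => ?_⟩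
  by_contra hne
  have hd : 0 < |∫ x, h j x * f x ∂P - c j| := abs_pos.2 (sub_ne_zero.2 hne)
  -- With this `ε` the error `2 ε C` is `d C / (C + 1) < d`, a contradiction; `C + 1` also covers `C
  -- = 0`.
  have := (key j (|∫ x, h j x * f x ∂P - c j| / (2 * (C + 1))) (by positivity)).2
  set d := |∫ x, h j x * f x ∂P - c j|
  have h3 : 2 * (d / (2 * (C + 1)) * C) = d * (C / (C + 1)) := by field_simp
  have h4 : C / (C + 1) < 1 := (div_lt_one (by positivity)).2 (by linarith)
  rw [h3] at this
  nlinarith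

/-- The direct method on the sublevel sets just above the infimum. They are midpoint convex, and the
constraint function 1 bounds them in `L¹`. -/
theorem exists_isFeasible_minimizer [IsProbabilityMeasure P] (hφ : IsDivergenceFunction φ)
    (hdom : ∀ j, IsDominated φ (h j) P) (hm : ∀ j, Measurable (h j))
    {j₀ : ι} (hj₀ : h j₀ = fun _ => 1) {f₀ : 𝓧 → ℝ} (hf₀ : IsFeasible h c P f₀)
    (hfin : ∫⁻ x, φ (f₀ x) ∂P < ⊤) :
    ∃ f, IsFeasible h c P f ∧
      ∀ f', IsFeasible h c P f' → ∫⁻ x, φ (f x) ∂P ≤ ∫⁻ x, φ (f' x) ∂P := by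
  set J : (𝓧 → ℝ) → ℝ≥0∞ := fun f => ∫⁻ x, φ (f x) ∂P with hJ
  set I : ℝ≥0∞ := sInf (J '' {f | IsFeasible h c P f}) with hI
  have hIle : ∀ f, IsFeasible h c P f → I ≤ J f := fun f hf => sInf_le ⟨f, hf, rfl⟩
  have hIfin : I ≠ ⊤ := ((hIle f₀ hf₀).trans_lt hfin).ne
  set K : ℕ → Set (𝓧 → ℝ) :=
    fun n => {f | IsFeasible h c P f ∧ J f ≤ I + ((n : ℝ≥0∞) + 1)⁻¹} with hK
  have hanti : Antitone K := fun n m hnm f hf => ⟨hf.1, hf.2.trans (by gcongr)⟩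
  have hne : ∀ n, (K n).Nonempty := fun n => by
    have : I < I + ((n : ℝ≥0∞) + 1)⁻¹ :=
      ENNReal.lt_add_right hIfin (ENNReal.inv_ne_zero.2 (by finiteness))
    obtain ⟨_, ⟨f, hf, rfl⟩, hlt⟩ := sInf_lt_iff.1 this
    exact ⟨f, hf, hlt.le⟩
  have hmass : ∀ f, IsFeasible h c P f → ∫⁻ x, ENNReal.ofReal (f x) ∂P = ENNReal.ofReal (c j₀) := by
    intro f hf
    have hi : Integrable f P := by simpa [hj₀] using hf.integrable j₀
    rw [← ofReal_integral_eq_lintegral_ofReal hi (ae_of_all _ hf.nonneg), ← hf.integral_eq j₀, hj₀]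
    simp
  have hmid : ∀ n, ∀ f₁ ∈ K n, ∀ f₂ ∈ K n,
      (fun x => (1 - 1 / 2) * f₁ x + 1 / 2 * f₂ x) ∈ K n := by
    rintro n f₁ ⟨h₁, h₁'⟩ f₂ ⟨h₂, h₂'⟩
    refine ⟨h₁.convexComb h₂ (by norm_num) (by norm_num), ?_⟩
    refine (hφ.lintegral_combination_le h₁.measurable (by norm_num) (by norm_num)).trans ?_
    calc _ ≤ ENNReal.ofReal (1 - 1 / 2) * (I + ((n : ℝ≥0∞) + 1)⁻¹) +
          ENNReal.ofReal (1 / 2) * (I + ((n : ℝ≥0∞) + 1)⁻¹) := by gcongr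
      _ = I + ((n : ℝ≥0∞) + 1)⁻¹ := by
        rw [← add_mul, ← ENNReal.ofReal_add (by norm_num) (by norm_num)]
        norm_num
  obtain ⟨u, f, hfm, hf0, huK, hlim⟩ := exists_seq_tendsto_ae_of_midpoint_convex (P := P) hanti hne
    (fun f hf => hf.1.measurable) (fun f hf => hf.1.nonneg) ENNReal.ofReal_ne_top
    (fun f hf => (hmass f hf.1).le) hmid
  have hJf : J f ≤ I := by
    refine (lintegral_le_liminf_of_tendsto hφ (fun n => (huK n).1.measurable) hlim).trans ?_
    have hlimI : Tendsto (fun n : ℕ => I + ((n : ℝ≥0∞) + 1)⁻¹) atTop (𝓝 I) := by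
      have h1 : Tendsto (fun n : ℕ => ((n + 1 : ℕ) : ℝ≥0∞)⁻¹) atTop (𝓝 0) :=
        ENNReal.tendsto_inv_nat_nhds_zero.comp (tendsto_add_atTop_nat 1)
      have h2 := h1.const_add I
      simpa using h2
    rw [← hlimI.liminf_eq]
    exact liminf_le_liminf (Eventually.of_forall fun n => (huK n).2)
  have hI1 : ENNReal.ofReal (I + 1).toReal = I + 1 := ENNReal.ofReal_toReal (by finiteness)
  refine ⟨f, IsFeasible.of_tendsto hdom hm (fun n => (huK n).1) hfm hf0 hlim
    (C := (I + 1).toReal) ENNReal.toReal_nonneg (fun n => ?_) ?_, fun f' hf' => hJf.trans (hIle f' hf')⟩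
  · rw [hI1]
    refine (huK n).2.trans ?_
    gcongr
    exact ENNReal.inv_le_one.2 le_add_self
  · rw [hI1]
    exact hJf.trans le_self_add

/-- The gap in the convexity inequality for `φ` on `[0, x]`, divided by the weight `t` of `x`, tends
to `∞` as `t → 0` if `φ` is steep at `0`. -/
lemma tendsto_quotient_of_steep (hφ : IsDivergenceFunction φ)
    (hsteep : Tendsto (deriv fun y => (φ y).toReal) (𝓝[>] (0 : ℝ)) atBot)
    {t : ℕ → ℝ} (ht0 : ∀ n, 0 < t n) (ht1 : ∀ n, t n < 1) (ht : Tendsto t atTop (𝓝 0))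
    {x : ℝ} (hx : 0 < x) (hφx : φ x < ⊤) (hφ0 : φ 0 < ⊤) :
    Tendsto (fun n => (ENNReal.ofReal (1 - t n) * φ 0 + ENNReal.ofReal (t n) * φ x -
      φ ((1 - t n) * 0 + t n * x)) / ENNReal.ofReal (t n)) atTop (𝓝 ⊤) := by
  set U : ℝ → ℝ := fun y => (φ y).toReal with hU
  have hseg : ∀ y ∈ Icc 0 x, φ y < ⊤ := fun y hy => by
    have := hφ.le_combination 0 x (s := y / x) (div_nonneg hy.1 hx.le) ((div_le_one hx).2 hy.2)
    rw [mul_zero, zero_add, div_mul_cancel₀ _ hx.ne'] at this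
    exact this.trans_lt (by finiteness)
  have hconv : ConvexOn ℝ (Icc 0 x) U := by
    refine ⟨convex_Icc _ _, fun y hy z hz a b ha hb hab => ?_⟩
    obtain rfl : a = 1 - b := by linarith
    have h1 := ENNReal.toReal_mono
      (by have := hseg y hy; have := hseg z hz; finiteness)
      (hφ.le_combination y z hb (by linarith))
    have h2 := hseg y hy
    have h3 := hseg z hz
    rw [ENNReal.toReal_add (by finiteness) (by finiteness), ENNReal.toReal_mul,
      ENNReal.toReal_mul, ENNReal.toReal_ofReal ha, ENNReal.toReal_ofReal hb] at h1
    simpa [hU] using h1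
  have htx : Tendsto (fun n => t n * x) atTop (𝓝[>] (0 : ℝ)) := by
    refine tendsto_nhdsWithin_iff.2 ⟨by simpa using ht.mul_const x, Eventually.of_forall fun n => ?_⟩
    exact mul_pos (ht0 n) hx
  have hderiv := hsteep.comp htx
  have hlower : Tendsto (fun n => -x * deriv U (t n * x)) atTop atTop :=
    hderiv.const_mul_atBot_of_neg (by linarith)
  -- Convexity gives `U (t x) ≤ U 0 + t x U'(t x)`. Hence the gap divided by `t` is at least `-U 0 -
  -- x U'(t x)`, after dropping `U x ≥ 0`.
  have hbig : Tendsto (fun n => -U 0 + -x * deriv U (t n * x)) atTop atTop :=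
    tendsto_atTop_add_const_left _ _ hlower
  refine tendsto_nhds_top_mono (ENNReal.tendsto_ofReal_atTop.comp hbig) ?_
  filter_upwards [hderiv.eventually (eventually_lt_atBot 0), hbig.eventually_ge_atTop 0]
    with n hn hbn
  -- `deriv` is 0 where differentiability fails, so a negative value certifies it.
  have hd : DifferentiableAt ℝ U (t n * x) := differentiableAt_of_deriv_ne_zero (ne_of_lt hn)
  have hpos : 0 < t n * x := mul_pos (ht0 n) hx
  have hmem : t n * x ∈ Icc 0 x := ⟨hpos.le, by nlinarith [ht1 n]⟩
  have hs := hconv.slope_le_deriv ⟨le_rfl, hx.le⟩ hmem hpos hd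
  rw [slope_def_field, sub_zero, div_le_iff₀ hpos] at hs
  have hUx : 0 ≤ U x := ENNReal.toReal_nonneg
  have h1t : 0 ≤ 1 - t n := by linarith [ht1 n]
  simp only [Function.comp_apply, mul_zero, zero_add]
  rw [ENNReal.le_div_iff_mul_le (by simp [ht0 n]) (by simp)]
  refine ENNReal.le_sub_of_add_le_right (hseg _ hmem).ne ?_
  have e0 : φ 0 = ENNReal.ofReal (U 0) := (ENNReal.ofReal_toReal hφ0.ne).symm
  have e1 : φ x = ENNReal.ofReal (U x) := (ENNReal.ofReal_toReal hφx.ne).symm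
  have e2 : φ (t n * x) = ENNReal.ofReal (U (t n * x)) :=
    (ENNReal.ofReal_toReal (hseg _ hmem).ne).symm
  have hU0 : 0 ≤ U 0 := ENNReal.toReal_nonneg
  rw [e0, e1, e2, ← ENNReal.ofReal_mul' (ht0 n).le, ← ENNReal.ofReal_mul h1t,
    ← ENNReal.ofReal_mul (ht0 n).le, ← ENNReal.ofReal_add (by positivity)
      (mul_nonneg (ht0 n).le hUx)]
  rw [← ENNReal.ofReal_add (mul_nonneg hbn (ht0 n).le) ENNReal.toReal_nonneg]
  refine ENNReal.ofReal_le_ofReal ?_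
  nlinarith [mul_nonneg (ht0 n).le hUx]

/-- The convexity gaps along the segment from `f` to `f₀`, divided by `t`, have integrals at most `J
f₀` because `f` is a minimizer. By Fatou their liminf is finite a.e., whereas it is infinite
wherever `f = 0 < f₀` and both `φ` values are finite. -/
lemma ae_pos_of_steep (hφ : IsDivergenceFunction φ)
    (hsteep : Tendsto (deriv fun y => (φ y).toReal) (𝓝[>] (0 : ℝ)) atBot)
    {f f₀ : 𝓧 → ℝ} (hf : IsFeasible h c P f) (hf₀ : IsFeasible h c P f₀)
    (hmin : ∀ f', IsFeasible h c P f' → ∫⁻ x, φ (f x) ∂P ≤ ∫⁻ x, φ (f' x) ∂P)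
    (hfin : ∫⁻ x, φ (f₀ x) ∂P < ⊤) (hpos : ∀ᵐ x ∂P, 0 < f₀ x) : ∀ᵐ x ∂P, 0 < f x := by
  have hffin : ∫⁻ x, φ (f x) ∂P < ⊤ := (hmin f₀ hf₀).trans_lt hfin
  have hmf : Measurable fun x => φ (f x) := hφ.measurable.comp hf.measurable
  have hmf₀ : Measurable fun x => φ (f₀ x) := hφ.measurable.comp hf₀.measurable
  -- The weights are `1 / (n + 2)`; the shift keeps `t 0 < 1`.
  set t : ℕ → ℝ := fun n => 1 / ((n + 1 : ℕ) + 1 : ℝ) with ht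
  have ht0 : ∀ n, 0 < t n := fun n => by positivity
  have ht1 : ∀ n, t n < 1 := fun n => by
    rw [ht, div_lt_one (by positivity)]
    have : (0 : ℝ) ≤ n := n.cast_nonneg
    push_cast
    linarith
  have htlim : Tendsto t atTop (𝓝 0) :=
    (tendsto_one_div_add_atTop_nhds_zero_nat (𝕜 := ℝ)).comp (tendsto_add_atTop_nat 1)
  set D : ℕ → 𝓧 → ℝ≥0∞ := fun n x => (ENNReal.ofReal (1 - t n) * φ (f x) +
    ENNReal.ofReal (t n) * φ (f₀ x) - φ ((1 - t n) * f x + t n * f₀ x)) / ENNReal.ofReal (t n)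
    with hD
  have hmt : ∀ n, Measurable fun x => φ ((1 - t n) * f x + t n * f₀ x) := fun n =>
    hφ.measurable.comp ((hf.measurable.const_mul _).add (hf₀.measurable.const_mul _))
  have hDm : ∀ n, Measurable (D n) := fun n =>
    (((hmf.const_mul _).add (hmf₀.const_mul _)).sub (hmt n)).div_const _
  have hDint : ∀ n, ∫⁻ x, D n x ∂P ≤ ∫⁻ x, φ (f₀ x) ∂P := fun n => by
    have htfin : ∫⁻ x, φ ((1 - t n) * f x + t n * f₀ x) ∂P ≠ ⊤ :=
      ((hφ.lintegral_combination_le hf.measurable (ht0 n).le (ht1 n).le).trans_lt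
        (by finiteness)).ne
    simp only [hD, div_eq_mul_inv]
    rw [lintegral_mul_const' _ _ (by simp [ht0 n]), lintegral_sub (hmt n) htfin
      (ae_of_all _ fun x => hφ.le_combination _ _ (ht0 n).le (ht1 n).le),
      lintegral_add_left (hmf.const_mul _), lintegral_const_mul _ hmf, lintegral_const_mul _ hmf₀,
      ← div_eq_mul_inv]
    -- Minimality bounds `(1 - t) J f` by `J` of the combination, leaving only `t J f₀`.
    refine ENNReal.div_le_of_le_mul (tsub_le_iff_right.2 ?_)
    rw [add_comm, mul_comm]
    gcongr
    refine le_trans ?_ (hmin _ (hf.convexComb hf₀ (ht0 n).le (ht1 n).le))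
    refine mul_le_of_le_one_left zero_le (ENNReal.ofReal_le_one.2 ?_)
    linarith [ht0 n]
  have hlim : ∫⁻ x, liminf (fun n => D n x) atTop ∂P < ⊤ :=
    ((lintegral_liminf_le hDm).trans (liminf_le_of_le (by isBoundedDefault) fun b hb => by
      obtain ⟨n, hn⟩ := hb.exists
      exact hn.trans (hDint n))).trans_lt hfin
  filter_upwards [ae_lt_top (Measurable.liminf hDm) hlim.ne, hpos, ae_lt_top hmf hffin.ne,
    ae_lt_top hmf₀ hfin.ne] with x h1 h2 h3 h4
  refine (hf.nonneg x).lt_of_ne fun h5 => ?_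
  rw [← h5] at h3
  have h6 := (tendsto_quotient_of_steep hφ hsteep ht0 ht1 htlim h2 h4 h3).liminf_eq
  simp only [hD, ← h5, h6] at h1
  exact lt_irrefl _ h1

end Minimizer

/-! ### From minimizing densities to projections -/

section Projection

variable {𝓧 : Type*} [MeasurableSpace 𝓧] {P : Measure 𝓧} [IsProbabilityMeasure P]
  {φ : ℝ → ℝ≥0∞} {l : ℕ} {g : Fin l → 𝓧 → ℝ}

/-- If `φ` is infinite on the negative half-line and the constraint functions are dominated, then
a `φ`-projection exists; it has a feasible density that minimizes the divergence. -/
theorem exists_isProjection (hφ : IsDivergenceFunction φ) (hg : ∀ i, Measurable (g i))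
    (hA : divergenceSet φ (constraintSet g P) P < ⊤) (hneg : ∀ x < 0, φ x = ⊤)
    (hdom : ∀ j, IsDominated φ (withOne g j) P) :
    ∃ f, IsFeasible (withOne g) (massOne l) P f ∧ ∫⁻ x, φ (f x) ∂P < ⊤ ∧
      (∀ f', IsFeasible (withOne g) (massOne l) P f' →
        ∫⁻ x, φ (f x) ∂P ≤ ∫⁻ x, φ (f' x) ∂P) ∧
      IsProjection φ (constraintSet g P) P (P.withDensityᵥ f) := by
  have hm : ∀ j, Measurable (withOne g j) := by
    rintro (_ | i)
    exacts [measurable_const, hg i]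
  obtain ⟨Q, hQ, hQfin⟩ : ∃ Q ∈ constraintSet g P, divergence φ Q P < ⊤ := by
    simpa only [divergenceSet, iInf_lt_iff, exists_prop] using hA
  obtain ⟨f₀, hf₀, -, -, hf₀Q⟩ := exists_isFeasible_of_mem hφ.measurable hneg hQ hQfin
  have hf₀fin : ∫⁻ x, φ (f₀ x) ∂P < ⊤ := hf₀Q ▸ hQfin
  obtain ⟨f, hf, hmin⟩ := exists_isFeasible_minimizer hφ hdom hm (j₀ := none) rfl hf₀ hf₀fin
  refine ⟨f, hf, (hmin f₀ hf₀).trans_lt hf₀fin, hmin, hA,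
    (withDensityᵥ_mem_constraintSet_iff hf.measurable hf.nonneg hf.integrable_self).2 hf,
    fun Q' hQ' => ?_⟩
  rw [divergence_withDensityᵥ φ hf.integrable_self]
  rcases eq_or_ne (divergence φ Q' P) ⊤ with htop | htop
  · rw [htop]; exact le_top
  · obtain ⟨f', hf', -, -, hf'Q⟩ := exists_isFeasible_of_mem hφ.measurable hneg hQ' htop.lt_top
    exact hf'Q ▸ hmin f' hf'

lemma existsProjectionSameSupport_of_map_zero (hφ : IsDivergenceFunction φ)
    (hg : ∀ i, Measurable (g i)) (hA : divergenceSet φ (constraintSet g P) P < ⊤)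
    (hdom : ∀ j, IsDominated φ (withOne g j) P) (h0 : φ 0 = ⊤) :
    ExistsProjectionSameSupport φ g P := by
  obtain ⟨f, hf, hfin, -, hproj⟩ :=
    exists_isProjection hφ hg hA (fun x hx => hφ.eq_top_of_neg_of_map_zero h0 hx) hdom
  refine ⟨_, hproj, ?_⟩
  filter_upwards [rnDeriv_withDensityᵥ_ae_eq hf.integrable_self,
    ae_lt_top (hφ.measurable.comp hf.measurable) hfin.ne] with x h1 h2
  rw [h1]
  refine (hf.nonneg x).lt_of_ne fun h3 => ?_
  simp [← h3, h0] at h2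

lemma existsProjectionSameSupport_of_steep (hφ : IsDivergenceFunction φ)
    (hg : ∀ i, Measurable (g i)) (hA : divergenceSet φ (constraintSet g P) P < ⊤)
    (hdom : ∀ j, IsDominated φ (withOne g j) P) (hs : SteepAtZero φ)
    (hpos : ExistsPositiveFeasible φ g P) : ExistsProjectionSameSupport φ g P := by
  have hneg : ∀ x < 0, φ x = ⊤ := fun x hx => eq_top_of_neg_of_leftEnd hs.2.1 hx
  obtain ⟨f, hf, hfin, hmin, hproj⟩ := exists_isProjection hφ hg hA hneg hdom
  obtain ⟨Q₀, hQ₀, hQ₀fin, hQ₀pos⟩ := hpos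
  obtain ⟨f₀, hf₀, -, hae, hf₀Q⟩ := exists_isFeasible_of_mem hφ.measurable hneg hQ₀ hQ₀fin
  have hf₀pos : ∀ᵐ x ∂P, 0 < f₀ x := by
    filter_upwards [hae, hQ₀pos] with x h1 h2
    rwa [← h1]
  refine ⟨_, hproj, ?_⟩
  filter_upwards [rnDeriv_withDensityᵥ_ae_eq hf.integrable_self,
    ae_pos_of_steep hφ hs.2.2 hf hf₀ hmin (hf₀Q ▸ hQ₀fin) hf₀pos] with x h1 h2
  rwa [h1]

/-- The mass constraint, whose function 1 is bounded, needs only (B); the moment constraints use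
(C). -/
lemma isDominated_withOne_of_conjugateIntegrable (hneg : ∀ x < 0, φ x = ⊤)
    (hg : ∀ i, Measurable (g i)) (hB : SuperlinearGrowth φ) (hC : ConjugateIntegrable φ g P) :
    ∀ j, IsDominated φ (withOne g j) P := by
  rintro (_ | i)
  · exact isDominated_of_memLp_top hB (memLp_const 1)
  · exact isDominated_of_conjugate hneg (hg i) fun α hα => hC α hα i

lemma isDominated_withOne_of_essBounded (hB : SuperlinearGrowth φ) (hE : EssBounded g P) :
    ∀ j, IsDominated φ (withOne g j) P := by
  rintro (_ | i)
  · exact isDominated_of_memLp_top hB (memLp_const 1)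
  · exact isDominated_of_memLp_top hB (hE i)

lemma isDominated_withOne_of_powerGrowthMoments (hD : PowerGrowthMoments φ g P) :
    ∀ j, IsDominated φ (withOne g j) P := by
  obtain ⟨r, k, hr, hk, hrk, hφ, hgk⟩ := hD
  rintro (_ | i)
  · exact isDominated_of_powerGrowth hr hk hrk hφ (memLp_const 1)
  · exact isDominated_of_powerGrowth hr hk hrk hφ (hgk i)

end Projection

end PhiDivergence

theorem mainTheorem12 {𝓧 : Type*} [MeasurableSpace 𝓧] (P : Measure 𝓧) [IsProbabilityMeasure P]
    (φ : ℝ → ℝ≥0∞) (hφ : IsDivergenceFunction φ)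
    {l : ℕ} (g : Fin l → 𝓧 → ℝ) (hg : ∀ i, Measurable (g i)) :
    -- (1)
    (divergenceSet φ (constraintSet g P) P < ⊤ → SuperlinearGrowth φ →
      ConjugateIntegrable φ g P → φ 0 = ⊤ → ExistsProjectionSameSupport φ g P) ∧
    -- (2)
    (divergenceSet φ (constraintSet g P) P < ⊤ → PowerGrowthMoments φ g P →
      φ 0 = ⊤ → ExistsProjectionSameSupport φ g P) ∧
    -- (3), first replacement in (1)
    (divergenceSet φ (constraintSet g P) P < ⊤ → SuperlinearGrowth φ →
      EssBounded g P → φ 0 = ⊤ → ExistsProjectionSameSupport φ g P) ∧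
    -- (3), second replacement in (1)
    (divergenceSet φ (constraintSet g P) P < ⊤ → SuperlinearGrowth φ →
      ConjugateIntegrable φ g P → SteepAtZero φ → ExistsPositiveFeasible φ g P →
      ExistsProjectionSameSupport φ g P) ∧
    -- (3), both replacements in (1)
    (divergenceSet φ (constraintSet g P) P < ⊤ → SuperlinearGrowth φ →
      EssBounded g P → SteepAtZero φ → ExistsPositiveFeasible φ g P →
      ExistsProjectionSameSupport φ g P) ∧
    -- (4)
    (divergenceSet φ (constraintSet g P) P < ⊤ → PowerGrowthMoments φ g P →
      SteepAtZero φ → ExistsPositiveFeasible φ g P →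
      ExistsProjectionSameSupport φ g P) := by
  have hF : φ 0 = ⊤ → ∀ x < 0, φ x = ⊤ := fun h0 x hx => hφ.eq_top_of_neg_of_map_zero h0 hx
  have hG : SteepAtZero φ → ∀ x < 0, φ x = ⊤ := fun hs x hx => eq_top_of_neg_of_leftEnd hs.2.1 hx
  refine ⟨fun hA hB hC h0 => ?_, fun hA hD h0 => ?_, fun hA hB hE h0 => ?_,
    fun hA hB hC hs hp => ?_, fun hA hB hE hs hp => ?_, fun hA hD hs hp => ?_⟩
  · exact existsProjectionSameSupport_of_map_zero hφ hg hA
      (isDominated_withOne_of_conjugateIntegrable (hF h0) hg hB hC) h0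
  · exact existsProjectionSameSupport_of_map_zero hφ hg hA
      (isDominated_withOne_of_powerGrowthMoments hD) h0
  · exact existsProjectionSameSupport_of_map_zero hφ hg hA
      (isDominated_withOne_of_essBounded hB hE) h0
  · exact existsProjectionSameSupport_of_steep hφ hg hA
      (isDominated_withOne_of_conjugateIntegrable (hG hs) hg hB hC) hs hp
  · exact existsProjectionSameSupport_of_steep hφ hg hA
      (isDominated_withOne_of_essBounded hB hE) hs hp
  · exact existsProjectionSameSupport_of_steep hφ hg hA
      (isDominated_withOne_of_powerGrowthMoments hD) hs hp
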